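/- Let $k\ge 1$ and $W\ge 0$ be integers. An ordered partition of $2^W$ into $k$ positive parts is a tuple $P=[p_1,\dots,p_k]$ of positive integers with $p_1+\dots+p_k=2^W$; tuples that differ in the order of their entries are different. Besides the targets $1,\dots,k$ with weights $p_1,\dots,p_k$, there is a special target $0$ ("unallocated"). A transaction of size $2^\ell$ (with an integer $\ell\ge 0$) from target $i$ to target $j\neq i$, where $i,j\in\{0,1,\dots,k\}$, replaces $p_i$ by $p_i-2^\ell$ and $p_j$ by $p_j+2^\ell$. A sequence of such transactions zeroes $P$ if after it the weights of the targets $1,\dots,k$ are all $0$. The complexity $\lambda(P)$ is the length of a shortest sequence of transactions, with sizes that are powers of $2$, that zeroes $P$. For $k\le 2^W$ and $W\ge 1$ let $$L(k,W)=\frac{\mathbb{E}[\lambda(P)]}{kW},$$ where $P$ is uniformly random among the ordered partitions of $2^W$ into $k$ positive parts. **Theorem.** For every integer $k\ge 2$ the limit $L(k)=\lim_{W\to\infty}L(k,W)$ exists and satisfies $\frac16\le L(k)\le\frac15$. Moreover, $L(2)=\frac16$. -/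

import Mathlib

open Filter Topology

/-- A transaction whose size is a power of two, between the targets `0, 1, …, k`:
`2 ^ level` units of weight are moved from target `src` to target `dst`.
Target `0` is the special target "unallocated". -/
structure Transaction (k : ℕ) where
  src : Fin (k + 1)
  dst : Fin (k + 1)
  src_ne_dst : src ≠ dst
  level : ℕ

/-- The effect of one transaction: subtract `2 ^ level` from the weight of `src`,
and add `2 ^ level` to the weight of `dst`. -/
def Transaction.apply {k : ℕ} (t : Transaction k) (x : Fin (k + 1) → ℤ) : Fin (k + 1) → ℤ :=
  fun i => if i = t.src then x i - 2 ^ t.level else if i = t.dst then x i + 2 ^ t.level else x i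

/-- The effect of a sequence of transactions, executed from left to right. -/
def applySeq {k : ℕ} (s : List (Transaction k)) (x : Fin (k + 1) → ℤ) : Fin (k + 1) → ℤ :=
  s.foldl (fun y t => t.apply y) x

/-- The weights before the first transaction: target `i` (for `1 ≤ i ≤ k`) has weight `p_i`
and nothing is unallocated. -/
def initialWeights {k : ℕ} (P : Fin k → ℕ) : Fin (k + 1) → ℤ :=
  Fin.cons 0 (fun i => (P i : ℤ))

/-- The sequence `s` zeroes `P`: after it, each of the targets `1, …, k` has weight `0`. -/
def Zeroes {k : ℕ} (s : List (Transaction k)) (P : Fin k → ℕ) : Prop :=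
  ∀ i : Fin k, applySeq s (initialWeights P) i.succ = 0

/-- Some sequence zeroes `P`: move the units to target `0` one at a time. -/
theorem exists_zeroes {k : ℕ} (P : Fin k → ℕ) : ∃ s : List (Transaction k), Zeroes s P := by
  suffices h : ∀ (n : ℕ) (x : Fin (k + 1) → ℤ), (∀ i : Fin k, 0 ≤ x i.succ) →
      ∑ i : Fin k, x i.succ = n →
      ∃ s : List (Transaction k), ∀ i : Fin k, applySeq s x i.succ = 0 by
    refine h (∑ i, P i) (initialWeights P) (fun i => ?_) ?_ <;> simp [initialWeights]
  intro n
  induction n with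
  | zero =>
    intro x hx hs
    have h0 := (Finset.sum_eq_zero_iff_of_nonneg (fun i _ => hx i)).1 (by simpa using hs)
    exact ⟨[], fun i => h0 i (Finset.mem_univ i)⟩
  | succ n ih =>
    intro x hx hs
    obtain ⟨i, hi⟩ : ∃ i : Fin k, 0 < x i.succ := by
      by_contra! hcon
      have := Finset.sum_nonpos (fun i (_ : i ∈ Finset.univ) => hcon i)
      push_cast at hs
      omega
    let t : Transaction k := ⟨i.succ, 0, Fin.succ_ne_zero i, 0⟩
    have ht : ∀ j : Fin k, t.apply x j.succ = x j.succ - if j = i then 1 else 0 := by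
      intro j
      by_cases hj : j = i <;> simp [t, Transaction.apply, hj]
    obtain ⟨s, h⟩ := ih (t.apply x)
      (fun j => by
        have := hx j
        rw [ht]
        split_ifs with hj
        · subst hj; omega
        · omega)
      (by simp only [ht, Finset.sum_sub_distrib, hs]; simp)
    exact ⟨t :: s, h⟩

/-- The complexity `λ(P)`: the length of a shortest sequence of transactions, with sizes
that are powers of two, that zeroes `P`. -/
noncomputable def complexity {k : ℕ} (P : Fin k → ℕ) : ℕ :=
  sInf {n : ℕ | ∃ s : List (Transaction k), s.length = n ∧ Zeroes s P}

/-- The minimum in the definition of the complexity is attained. -/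
theorem exists_zeroes_length_eq_complexity {k : ℕ} (P : Fin k → ℕ) :
    ∃ s : List (Transaction k), s.length = complexity P ∧ Zeroes s P := by
  obtain ⟨s, hs⟩ := exists_zeroes P
  exact Nat.sInf_mem (s := {n : ℕ | ∃ s : List (Transaction k), s.length = n ∧ Zeroes s P})
    ⟨s.length, s, rfl, hs⟩

/-- The ordered partitions of `2 ^ W` into `k` positive integer parts. -/
def orderedPartitions (k W : ℕ) : Finset (Fin k → ℕ) :=
  (Finset.piAntidiag Finset.univ (2 ^ W)).filter (fun P => ∀ i, 0 < P i)

theorem mem_orderedPartitions {k W : ℕ} {P : Fin k → ℕ} :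
    P ∈ orderedPartitions k W ↔ (∀ i, 0 < P i) ∧ ∑ i, P i = 2 ^ W := by
  simp [orderedPartitions, and_comm]

/-- The expectation of `λ(P)`, for `P` uniformly distributed on the ordered partitions of `2 ^ W`
into `k` positive parts (a nonempty set if `1 ≤ k ≤ 2 ^ W`). -/
noncomputable def expectedComplexity (k W : ℕ) : ℝ :=
  (∑ P ∈ orderedPartitions k W, (complexity P : ℝ)) / (orderedPartitions k W).card

/-- The normalized expected complexity `L(k, W) = E[λ(P)] / (k W)`. -/
noncomputable def normalizedExpectedComplexity (k W : ℕ) : ℝ :=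
  expectedComplexity k W / ((k : ℝ) * (W : ℝ))

/-!
Since transactions commute, the complexity extends to a word length `cost` on `ℤ ^ k`, which is
subadditive and satisfies `cost (2 • x) ≤ cost x`. Write `k = n + 1`.

*Existence of the limit.* Let `meanCost n W` be the average cost of `(-∑ t, t)` for `t` uniform in
`[0, 2 ^ W) ^ n`. Clearing the low bits first and the high bits afterwards shows that it is
subadditive in `W`, so `meanCost n W / W` converges (Fekete's lemma, `tendsto_meanCost_div`).
A random ordered partition of `2 ^ W` has almost this distribution: fix `j`, and reduce all parts
but the first modulo `2 ^ (W - j)`. The top `j` bits change the cost by at most a constant, and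
every vector of residues comes from nearly the same number of partitions, as this number lies
between two simplex counts whose ratio tends to `1` as `j → ∞`. This is
`exists_expectedComplexity_near`, and it gives `L(k) = lim meanCost n W / (k W)`.

*Lower bound.* One transaction touches at most two targets, so `cost x` is at least half the sum of
the weights of the `x i`, where the weight of an integer is the least number of signed powers of two
with that sum. The average weight of a `W`-bit number is `W / 3 + O(1)` by a linear recursion (`sum_weight_range_two_pow`), which gives `1 / 6`. For
two targets `(-t, t)` costs at most the weight of `t`, so that the bound is attained.

*Upper bound.* With at least three targets, clear one bit position after the other, by pairing the
odd entries and moving one unit inside each pair, in the direction that leaves the first entry of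
the pair divisible by four. The second one then has an odd half with probability `1 / 2`, since the
next bits of two entries are independent. If `m` entries are odd, `m / 2` transactions leave
`k / 2 - m / 4` odd entries on average, so `2 m / 5` is a potential with respect to which every bit
position costs `k / 5` (`exists_halving`, `exists_boxMean_cost_le`).
-/

/-! ### Word lengths in additive groups -/

/-- The length of a shortest list of elements of `S` with sum `x`
(the junk value `0` if there is no such list). -/
noncomputable def wordLength {G : Type*} [AddCommGroup G] (S : Set G) (x : G) : ℕ :=
  sInf {n : ℕ | ∃ l : List G, l.length = n ∧ (∀ g ∈ l, g ∈ S) ∧ l.sum = x}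

section WordLength

variable {G H : Type*} [AddCommGroup G] [AddCommGroup H] {S : Set G}

theorem wordLength_le_of_list {l : List G} (hl : ∀ g ∈ l, g ∈ S) :
    wordLength S l.sum ≤ l.length :=
  Nat.sInf_le ⟨l, rfl, hl, rfl⟩

theorem exists_list_length_eq_wordLength (hS : AddSubmonoid.closure S = ⊤) (x : G) :
    ∃ l : List G, l.length = wordLength S x ∧ (∀ g ∈ l, g ∈ S) ∧ l.sum = x := by
  obtain ⟨l, hl, hx⟩ := AddSubmonoid.exists_list_of_mem_closure
    (show x ∈ AddSubmonoid.closure S by rw [hS]; trivial)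
  exact Nat.sInf_mem
    (s := {n : ℕ | ∃ l : List G, l.length = n ∧ (∀ g ∈ l, g ∈ S) ∧ l.sum = x})
    ⟨l.length, l, rfl, hl, hx⟩

theorem wordLength_zero : wordLength S (0 : G) = 0 := by
  have := wordLength_le_of_list (S := S) (l := []) (by simp)
  simpa using this

theorem wordLength_le_one {g : G} (hg : g ∈ S) : wordLength S g ≤ 1 := by
  have := wordLength_le_of_list (S := S) (l := [g]) (by simpa using hg)
  simpa using this

theorem wordLength_add_le (hS : AddSubmonoid.closure S = ⊤) (x y : G) :
    wordLength S (x + y) ≤ wordLength S x + wordLength S y := by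
  obtain ⟨l, hl, hlS, rfl⟩ := exists_list_length_eq_wordLength hS x
  obtain ⟨m, hm, hmS, rfl⟩ := exists_list_length_eq_wordLength hS y
  rw [← hl, ← hm, ← List.sum_append, ← List.length_append]
  exact wordLength_le_of_list fun g hg => (List.mem_append.1 hg).elim (hlS g) (hmS g)

/-- The word length is the largest function that vanishes at `0` and grows by at most `1`
along each generator; here with growth at most `c` per generator. -/
theorem le_mul_wordLength (hS : AddSubmonoid.closure S = ⊤) {φ : G → ℕ} (c : ℕ)
    (h0 : φ 0 = 0) (hφ : ∀ g ∈ S, ∀ x, φ (g + x) ≤ φ x + c) (x : G) :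
    φ x ≤ c * wordLength S x := by
  obtain ⟨l, hl, hlS, rfl⟩ := exists_list_length_eq_wordLength hS x
  rw [← hl]
  clear hl
  induction l with
  | nil => simp [h0]
  | cons g l ih =>
    have h1 := ih fun a ha => hlS a (List.mem_cons_of_mem g ha)
    have h2 := hφ g (hlS g List.mem_cons_self) l.sum
    rw [List.sum_cons, List.length_cons, mul_add, mul_one]
    omega

theorem wordLength_map_le {T : Set H} (hS : AddSubmonoid.closure S = ⊤)
    (hT : AddSubmonoid.closure T = ⊤) (f : G →+ H) (hf : ∀ g ∈ S, f g ∈ T) (x : G) :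
    wordLength T (f x) ≤ wordLength S x := by
  have := le_mul_wordLength hS (φ := fun x => wordLength T (f x)) 1 (by simp [wordLength_zero])
    (fun g hg x => by
      rw [map_add, add_comm]
      exact (wordLength_add_le hT _ _).trans (Nat.add_le_add_left (wordLength_le_one (hf g hg)) _))
    x
  simpa using this

theorem wordLength_neg (hS : AddSubmonoid.closure S = ⊤) (hneg : ∀ g ∈ S, -g ∈ S) (x : G) :
    wordLength S (-x) = wordLength S x := by
  refine le_antisymm (wordLength_map_le hS hS (-AddMonoidHom.id G) hneg x) ?_
  have := wordLength_map_le hS hS (-AddMonoidHom.id G) hneg (-x)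
  simpa using this

theorem wordLength_le_add_sub (hS : AddSubmonoid.closure S = ⊤) (hneg : ∀ g ∈ S, -g ∈ S)
    (x y : G) : wordLength S x ≤ wordLength S (x + y) + wordLength S y := by
  have := wordLength_add_le hS (x + y) (-y)
  rwa [wordLength_neg hS hneg, add_neg_cancel_right] at this

end WordLength

/-! ### Transactions as generators of a lattice -/

/-- The weight that a transaction removes from each of the targets `1, …, k`. -/
def Transaction.removed {k : ℕ} (t : Transaction k) : Fin k → ℤ :=
  fun i => if i.succ = t.src then 2 ^ t.level else if i.succ = t.dst then -2 ^ t.level else 0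

/-- The set of all vectors removed by a single transaction. -/
def moves (k : ℕ) : Set (Fin k → ℤ) := Set.range Transaction.removed

theorem applySeq_succ {k : ℕ} (s : List (Transaction k)) (x : Fin (k + 1) → ℤ) (i : Fin k) :
    applySeq s x i.succ = x i.succ - (s.map Transaction.removed).sum i := by
  induction s generalizing x with
  | nil => simp [applySeq]
  | cons t s ih =>
    have h := ih (t.apply x)
    simp only [applySeq, List.foldl_cons, List.map_cons, List.sum_cons, Pi.add_apply] at h ⊢
    rw [h]
    simp only [Transaction.apply, Transaction.removed]
    split_ifs <;> ring

theorem complexity_eq_wordLength {k : ℕ} (P : Fin k → ℕ) :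
    complexity P = wordLength (moves k) (fun i => (P i : ℤ)) := by
  unfold complexity wordLength
  congr 1
  ext m
  have key (s : List (Transaction k)) :
      Zeroes s P ↔ (s.map Transaction.removed).sum = fun i => (P i : ℤ) := by
    simp only [Zeroes, applySeq_succ, initialWeights, Fin.cons_succ, sub_eq_zero, funext_iff]
    exact forall_congr' fun i => eq_comm
  simp only [Set.mem_ofPred_eq, key]
  constructor
  · rintro ⟨s, rfl, hs⟩
    refine ⟨s.map Transaction.removed, by simp, fun g hg => ?_, hs⟩
    obtain ⟨t, -, rfl⟩ := List.mem_map.1 hg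
    exact ⟨t, rfl⟩
  · rintro ⟨l, rfl, hl, hs⟩
    obtain ⟨s, rfl⟩ : ∃ s : List (Transaction k), s.map Transaction.removed = l := by
      have : l ∈ Set.range (List.map (Transaction.removed (k := k))) := by
        rw [Set.range_list_map]
        exact hl
      exact this
    exact ⟨s, by simp, hs⟩

theorem neg_mem_moves {k : ℕ} {g : Fin k → ℤ} (hg : g ∈ moves k) : -g ∈ moves k := by
  obtain ⟨t, rfl⟩ := hg
  refine ⟨⟨t.dst, t.src, t.src_ne_dst.symm, t.level⟩, ?_⟩
  have := t.src_ne_dst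
  ext i
  simp only [Transaction.removed, Pi.neg_apply]
  split_ifs <;> simp_all

theorem two_smul_mem_moves {k : ℕ} {g : Fin k → ℤ} (hg : g ∈ moves k) :
    (2 : ℤ) • g ∈ moves k := by
  obtain ⟨t, rfl⟩ := hg
  refine ⟨⟨t.src, t.dst, t.src_ne_dst, t.level + 1⟩, ?_⟩
  ext i
  simp only [Transaction.removed, Pi.smul_apply, smul_eq_mul]
  split_ifs <;> ring

theorem single_mem_moves {k : ℕ} (i : Fin k) (l : ℕ) : Pi.single i (2 ^ l : ℤ) ∈ moves k := by
  refine ⟨⟨i.succ, 0, Fin.succ_ne_zero i, l⟩, ?_⟩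
  ext j
  simp [Transaction.removed, Pi.single_apply]

theorem single_sub_single_mem_moves {k : ℕ} {i j : Fin k} (hij : i ≠ j) (l : ℕ) :
    Pi.single i (2 ^ l : ℤ) - Pi.single j (2 ^ l : ℤ) ∈ moves k := by
  refine ⟨⟨i.succ, j.succ, by simpa using hij, l⟩, ?_⟩
  ext a
  rcases eq_or_ne a i with rfl | h1
  · simp [Transaction.removed, hij]
  · simp [Transaction.removed, Pi.single_apply, h1, apply_ite]

theorem closure_moves (k : ℕ) : AddSubmonoid.closure (moves k) = ⊤ := by
  refine (AddSubmonoid.eq_top_iff' _).2 fun x => ?_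
  rw [← Finset.univ_sum_single x]
  refine sum_mem fun i _ => ?_
  have h1 : Pi.single i (1 : ℤ) ∈ AddSubmonoid.closure (moves k) := by
    simpa using AddSubmonoid.subset_closure (single_mem_moves i 0)
  have h2 : -Pi.single i (1 : ℤ) ∈ AddSubmonoid.closure (moves k) := by
    simpa using AddSubmonoid.subset_closure (neg_mem_moves (single_mem_moves i 0))
  obtain ⟨m, hm | hm⟩ := Int.eq_nat_or_neg (x i)
  · convert nsmul_mem h1 m using 1
    ext j
    by_cases hj : j = i <;> simp [hm, hj]
  · convert nsmul_mem h2 m using 1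
    ext j
    by_cases hj : j = i <;> simp [hm, hj]

/-- The complexity of an arbitrary integer vector of weights of the targets `1, …, k`. -/
noncomputable abbrev cost {k : ℕ} (x : Fin k → ℤ) : ℕ := wordLength (moves k) x

section Cost

variable {k : ℕ}

theorem cost_add_le (x y : Fin k → ℤ) : cost (x + y) ≤ cost x + cost y :=
  wordLength_add_le (closure_moves k) x y

theorem cost_le_add (x y : Fin k → ℤ) : cost x ≤ cost (x + y) + cost y :=
  wordLength_le_add_sub (closure_moves k) (fun _ => neg_mem_moves) x y

theorem cost_two_smul_le (x : Fin k → ℤ) : cost ((2 : ℤ) • x) ≤ cost x :=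
  wordLength_map_le (closure_moves k) (closure_moves k)
    (DistribSMul.toAddMonoidHom (Fin k → ℤ) (2 : ℤ)) (fun _ => two_smul_mem_moves) x

theorem cost_two_pow_smul_le (a : ℕ) (x : Fin k → ℤ) : cost ((2 ^ a : ℤ) • x) ≤ cost x := by
  induction a with
  | zero => simp
  | succ a ih =>
    rw [pow_succ', mul_smul]
    exact (cost_two_smul_le _).trans ih

theorem exists_cost_le (B : ℤ) : ∃ C : ℕ, ∀ x : Fin k → ℤ, (∀ i, |x i| ≤ B) → cost x ≤ C := by
  obtain ⟨C, hC⟩ := ((Set.finite_Icc (fun _ : Fin k => -B) (fun _ => B)).image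
    (cost (k := k))).bddAbove
  exact ⟨C, fun x hx => hC ⟨x, ⟨fun i => (abs_le.1 (hx i)).1, fun i => (abs_le.1 (hx i)).2⟩, rfl⟩⟩

end Cost

/-! ### The minimal number of signed powers of two -/

/-- The powers of two and their negatives. -/
def signedPowers : Set ℤ := {z | ∃ l : ℕ, z = 2 ^ l ∨ z = -2 ^ l}

/-- The least number of signed powers of two with sum `z`, that is, the number of nonzero digits
of the non-adjacent form of `z`. -/
noncomputable abbrev weight (z : ℤ) : ℕ := wordLength signedPowers z

theorem closure_signedPowers : AddSubmonoid.closure signedPowers = ⊤ := by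
  refine (AddSubmonoid.eq_top_iff' _).2 fun x => ?_
  have h1 : (1 : ℤ) ∈ AddSubmonoid.closure signedPowers :=
    AddSubmonoid.subset_closure ⟨0, by simp⟩
  have h2 : (-1 : ℤ) ∈ AddSubmonoid.closure signedPowers :=
    AddSubmonoid.subset_closure ⟨0, by simp⟩
  obtain ⟨m, hm | hm⟩ := Int.eq_nat_or_neg x
  · simpa [hm] using nsmul_mem h1 m
  · simpa [hm] using nsmul_mem h2 m

theorem neg_mem_signedPowers {z : ℤ} (hz : z ∈ signedPowers) : -z ∈ signedPowers := by
  obtain ⟨l, rfl | rfl⟩ := hz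
  · exact ⟨l, Or.inr rfl⟩
  · exact ⟨l, Or.inl (neg_neg _)⟩

theorem weight_neg (z : ℤ) : weight (-z) = weight z :=
  wordLength_neg closure_signedPowers (fun _ => neg_mem_signedPowers) z

theorem weight_add_le (x y : ℤ) : weight (x + y) ≤ weight x + weight y :=
  wordLength_add_le closure_signedPowers x y

theorem weight_le_one {z : ℤ} (hz : z ∈ signedPowers) : weight z ≤ 1 := wordLength_le_one hz

theorem weight_le_weight_sub_add {x z : ℤ} (hz : z ∈ signedPowers) :
    weight x ≤ weight (x - z) + 1 := by
  have h1 := weight_add_le (x - z) z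
  have h2 := weight_le_one hz
  rw [sub_add_cancel] at h1
  omega

theorem weight_two_mul_le (x : ℤ) : weight (2 * x) ≤ weight x := by
  refine wordLength_map_le closure_signedPowers closure_signedPowers (AddMonoidHom.mulLeft 2)
    ?_ x
  rintro _ ⟨l, rfl | rfl⟩
  · exact ⟨l + 1, Or.inl (by simp [pow_succ'])⟩
  · exact ⟨l + 1, Or.inr (by simp [pow_succ'])⟩

theorem weight_two_pow_mul_le (a : ℕ) (x : ℤ) : weight (2 ^ a * x) ≤ weight x := by
  induction a with
  | zero => simp
  | succ a ih =>
    rw [pow_succ', mul_assoc]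
    exact (weight_two_mul_le _).trans ih

theorem weight_le_weight_add_one (x : ℤ) : weight x ≤ weight (x + 1) + 1 := by
  simpa using weight_le_weight_sub_add (x := x) (z := -1) ⟨0, by simp⟩

theorem weight_add_one_le (x : ℤ) : weight (x + 1) ≤ weight x + 1 := by
  simpa using weight_le_weight_sub_add (x := x + 1) (z := 1) ⟨0, by simp⟩

/-- The weight of `z` as it is computed from the lowest bit: an even `z` is halved, and an odd `z`
is first rounded up or down to an even number, at the price of one signed power of two. -/
noncomputable def weightStep (z : ℤ) : ℕ :=
  if z % 2 = 0 then weight (z / 2) else 1 + min (weight (z / 2)) (weight (z / 2 + 1))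

/-- The rounding of the lowest bit is optimal, since `weightStep` too grows by at most `1` along each
signed power of two. -/
theorem weightStep_le (z : ℤ) : weightStep z ≤ weight z := by
  have := le_mul_wordLength closure_signedPowers (φ := weightStep) 1
    (by simp [weightStep, wordLength_zero]) ?_ z
  · simpa using this
  rintro g ⟨l, hg⟩ x
  rcases l with _ | l
  · have e1 := weight_le_weight_add_one (x / 2)
    have e2 := weight_add_one_le (x / 2)
    have e3 := weight_le_weight_add_one (x / 2 - 1)
    have e4 := weight_add_one_le (x / 2 - 1)
    rw [sub_add_cancel] at e3 e4
    rcases Int.emod_two_eq_zero_or_one x with hx | hx <;> rcases hg with rfl | rfl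
    · have h1 : (2 ^ 0 + x) / 2 = x / 2 := by omega
      have h2 : (2 ^ 0 + x) % 2 = 1 := by omega
      simp only [weightStep, h1, h2, hx]
      simp
      omega
    · have h1 : (-2 ^ 0 + x) / 2 = x / 2 - 1 := by omega
      have h2 : (-2 ^ 0 + x) % 2 = 1 := by omega
      simp only [weightStep, h1, h2, hx]
      simp
      omega
    · have h1 : (2 ^ 0 + x) / 2 = x / 2 + 1 := by omega
      have h2 : (2 ^ 0 + x) % 2 = 0 := by omega
      simp only [weightStep, h1, h2, hx]
      simp
      omega
    · have h1 : (-2 ^ 0 + x) / 2 = x / 2 := by omega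
      have h2 : (-2 ^ 0 + x) % 2 = 0 := by omega
      simp only [weightStep, h1, h2, hx]
      simp
      omega
  · obtain ⟨h, hS, rfl⟩ : ∃ h ∈ signedPowers, g = 2 * h := by
      rcases hg with rfl | rfl
      · exact ⟨2 ^ l, ⟨l, Or.inl rfl⟩, by ring⟩
      · exact ⟨-2 ^ l, ⟨l, Or.inr rfl⟩, by ring⟩
    have h1 : (2 * h + x) / 2 = h + x / 2 := by omega
    have h2 : (2 * h + x) % 2 = x % 2 := by omega
    have e0 := weight_le_one hS
    have e1 := weight_add_le h (x / 2)
    have e2 := weight_add_le h (x / 2 + 1)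
    rw [← add_assoc] at e2
    simp only [weightStep, h1, h2]
    split_ifs <;> omega

theorem weight_two_mul (x : ℤ) : weight (2 * x) = weight x := by
  refine le_antisymm (weight_two_mul_le x) ?_
  simpa [weightStep] using weightStep_le (2 * x)

theorem weight_two_mul_add_one (x : ℤ) :
    weight (2 * x + 1) = 1 + min (weight x) (weight (x + 1)) := by
  apply le_antisymm
  · have h1 := weight_add_one_le (2 * x)
    have h2 := weight_le_weight_add_one (2 * x + 1)
    rw [show 2 * x + 1 + 1 = 2 * (x + 1) by ring] at h2
    have h3 := weight_two_mul_le x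
    have h4 := weight_two_mul_le (x + 1)
    omega
  · have := weightStep_le (2 * x + 1)
    have h1 : (2 * x + 1) / 2 = x := by omega
    have h2 : (2 * x + 1) % 2 = 1 := by omega
    simpa [weightStep, h1, h2] using this

theorem weight_four_mul_add_one (x : ℤ) : weight (4 * x + 1) = 1 + weight x := by
  have h1 := weight_two_mul_add_one (2 * x)
  have h2 := weight_two_mul_add_one x
  have h3 := weight_le_weight_add_one x
  rw [show 2 * (2 * x) + 1 = 4 * x + 1 by ring, weight_two_mul] at h1
  omega

theorem weight_four_mul_add_three (x : ℤ) : weight (4 * x + 3) = 1 + weight (x + 1) := by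
  have h1 := weight_two_mul_add_one (2 * x + 1)
  have h2 := weight_two_mul_add_one x
  have h3 := weight_add_one_le x
  rw [show 2 * (2 * x + 1) + 1 = 4 * x + 3 by ring, show 2 * x + 1 + 1 = 2 * (x + 1) by ring,
    weight_two_mul] at h1
  omega

theorem weight_two_pow (a : ℕ) : weight (2 ^ a) = 1 := by
  induction a with
  | zero =>
    have := weight_four_mul_add_one 0
    simpa [wordLength_zero] using this
  | succ a ih => rw [pow_succ', weight_two_mul, ih]

theorem sum_range_mul {M : Type*} [AddCommMonoid M] (f : ℕ → M) (m n : ℕ) :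
    ∑ x ∈ Finset.range (m * n), f x =
      ∑ y ∈ Finset.range n, ∑ r ∈ Finset.range m, f (m * y + r) := by
  induction n with
  | zero => simp
  | succ n ih => rw [mul_add, mul_one, Finset.sum_range_add, ih, Finset.sum_range_succ]

theorem sum_weight_recursion (W : ℕ) :
    ∑ x ∈ Finset.range (2 ^ (W + 2)), weight x =
      ∑ x ∈ Finset.range (2 ^ (W + 1)), weight x + 2 * ∑ x ∈ Finset.range (2 ^ W), weight x +
        2 * 2 ^ W + 1 := by
  have hshift : ∑ y ∈ Finset.range (2 ^ W), weight ((y : ℤ) + 1) =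
      ∑ y ∈ Finset.range (2 ^ W), weight (y : ℤ) + 1 := by
    have h1 := Finset.sum_range_succ (fun y : ℕ => weight (y : ℤ)) (2 ^ W)
    have h2 := Finset.sum_range_succ' (fun y : ℕ => weight (y : ℤ)) (2 ^ W)
    have h3 : weight (((2 ^ W : ℕ) : ℤ)) = 1 := by simpa using weight_two_pow W
    have h4 : weight ((0 : ℕ) : ℤ) = 0 := wordLength_zero
    simp only [Nat.cast_add, Nat.cast_one] at h2
    omega
  rw [show 2 ^ (W + 2) = 4 * 2 ^ W by ring, show 2 ^ (W + 1) = 2 * 2 ^ W by ring,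
    sum_range_mul _ 4, sum_range_mul _ 2]
  have e0 (y : ℕ) : weight ((4 * y + 0 : ℕ) : ℤ) = weight ((2 * y + 0 : ℕ) : ℤ) := by
    rw [← weight_two_mul (((2 * y + 0 : ℕ) : ℤ))]; congr 1; push_cast; ring
  have e1 (y : ℕ) : weight ((4 * y + 1 : ℕ) : ℤ) = 1 + weight (y : ℤ) := by
    rw [← weight_four_mul_add_one]; congr 1
  have e2 (y : ℕ) : weight ((4 * y + 2 : ℕ) : ℤ) = weight ((2 * y + 1 : ℕ) : ℤ) := by
    rw [← weight_two_mul (((2 * y + 1 : ℕ) : ℤ))]; congr 1; push_cast; ring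
  have e3 (y : ℕ) : weight ((4 * y + 3 : ℕ) : ℤ) = 1 + weight ((y : ℤ) + 1) := by
    rw [← weight_four_mul_add_three]; congr 1
  simp only [Finset.sum_range_succ, Finset.sum_range_zero, zero_add, e0, e1, e2, e3,
    Finset.sum_add_distrib, Finset.sum_const, Finset.card_range, smul_eq_mul, hshift]
  ring

/-- The average weight of the integers in `[0, 2 ^ W)` is `W / 3 + O(1)`. -/
theorem sum_weight_range_two_pow (W : ℕ) :
    ((∑ x ∈ Finset.range (2 ^ W), weight x : ℕ) : ℝ) =
      W * 2 ^ W / 3 + 4 / 9 * 2 ^ W + (-1) ^ W / 18 - 1 / 2 := by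
  induction W using Nat.strong_induction_on with
  | _ W ih =>
    match W, ih with
    | 0, _ => norm_num [wordLength_zero]
    | 1, _ =>
      have h := weight_two_pow 0
      norm_num [Finset.sum_range_succ, wordLength_zero] at h ⊢
      rw [h]
    | W + 2, ih =>
      rw [sum_weight_recursion]
      push_cast
      have h1 := ih W (by omega)
      have h2 := ih (W + 1) (by omega)
      push_cast at h1 h2
      rw [h1, h2]
      ring

/-! ### Averages over boxes -/

/-- The average of `f` over the integer points of the box `[0, N) ^ n`. -/
noncomputable def boxMean (n N : ℕ) (f : (Fin n → ℤ) → ℝ) : ℝ :=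
  Finset.expect Finset.univ fun u : Fin n → Fin N => f fun i => ((u i : ℕ) : ℤ)

section BoxMean

variable {n N : ℕ} {f g : (Fin n → ℤ) → ℝ}

theorem boxMean_mono
    (h : ∀ u : Fin n → ℤ, (∀ i, 0 ≤ u i ∧ u i < N) → f u ≤ g u) :
    boxMean n N f ≤ boxMean n N g :=
  Finset.expect_le_expect fun u _ => h _ fun i => ⟨by simp, by simp⟩

theorem boxMean_congr
    (h : ∀ u : Fin n → ℤ, (∀ i, 0 ≤ u i ∧ u i < N) → f u = g u) :
    boxMean n N f = boxMean n N g :=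
  le_antisymm (boxMean_mono fun u hu => (h u hu).le) (boxMean_mono fun u hu => (h u hu).ge)

theorem boxMean_add : boxMean n N (fun u => f u + g u) = boxMean n N f + boxMean n N g :=
  Finset.expect_add_distrib _ _ _

theorem boxMean_mul_left (a : ℝ) : boxMean n N (fun u => a * f u) = a * boxMean n N f :=
  (Finset.mul_expect _ _ _).symm

theorem boxMean_sum {ι : Type*} (s : Finset ι) (h : ι → (Fin n → ℤ) → ℝ) :
    boxMean n N (fun u => ∑ i ∈ s, h i u) = ∑ i ∈ s, boxMean n N (h i) :=
  Finset.expect_sum_comm _ _ _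

theorem boxMean_const [NeZero N] (a : ℝ) : boxMean n N (fun _ => a) = a :=
  Finset.expect_const Finset.univ_nonempty a

theorem boxMean_one (f : (Fin n → ℤ) → ℝ) : boxMean n 1 f = f 0 := by
  rw [← boxMean_const (n := n) (N := 1) (f 0)]
  refine boxMean_congr fun u hu => congrArg f (funext fun i => ?_)
  have := hu i
  simp only [Pi.zero_apply]
  omega

/-- Splitting each coordinate into its remainder and quotient modulo `M`. -/
theorem boxMean_mul (n N M : ℕ) (f : (Fin n → ℤ) → ℝ) :
    boxMean n (N * M) f =
      boxMean n M fun u => boxMean n N fun v => f (u + (M : ℤ) • v) := by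
  unfold boxMean
  rw [Finset.expect_comm, ← Finset.expect_product', Finset.univ_product_univ]
  symm
  refine Fintype.expect_equiv ((Equiv.arrowProdEquivProdArrow (Fin n) _ _).symm.trans
    (Equiv.piCongrRight fun _ => finProdFinEquiv)) _ _ fun p => ?_
  congr 1

/-- The average over the box is an average of averages over the lines in direction `l`. -/
theorem boxMean_eq_boxMean_line (l : Fin n) (f : (Fin n → ℤ) → ℝ) :
    boxMean n N f = boxMean n N fun u =>
      Finset.expect Finset.univ fun a : Fin N => f (Function.update u l ((a : ℕ) : ℤ)) := by
  rcases Nat.eq_zero_or_pos N with rfl | hN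
  · have : IsEmpty (Fin n → Fin 0) := ⟨fun u => (u l).elim0⟩
    simp [boxMean]
  have : NeZero N := ⟨hN.ne'⟩
  -- The exchange of `u l` and `a` is an involution of the pairs `(u, a)`.
  have hinv : Function.Involutive
      (fun p : (Fin n → Fin N) × Fin N => (Function.update p.1 l p.2, p.1 l)) := by
    rintro ⟨u, a⟩
    simp
  have h1 : boxMean n N f = Finset.expect Finset.univ
      fun p : (Fin n → Fin N) × Fin N => f fun i => ((p.1 i : ℕ) : ℤ) := by
    rw [← Finset.univ_product_univ, Finset.expect_product]
    exact Finset.expect_congr rfl fun u _ => (Finset.expect_const Finset.univ_nonempty _).symm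
  rw [h1]
  unfold boxMean
  rw [← Finset.expect_product', Finset.univ_product_univ]
  refine Fintype.expect_equiv hinv.toPerm _ _ fun p => congrArg f (funext fun i => ?_)
  rcases eq_or_ne i l with rfl | hi
  · simp
  · simp [hi]

end BoxMean

/-! ### Vectors with sum zero -/

/-- The vector with sum zero whose entries after the first one are those of `t`. -/
def zeroSumExt {n : ℕ} (t : Fin n → ℤ) : Fin (n + 1) → ℤ := Fin.cons (-∑ i, t i) t

section ZeroSumExt

variable {n : ℕ}

@[simp] theorem zeroSumExt_zero_apply (t : Fin n → ℤ) : zeroSumExt t 0 = -∑ i, t i := rfl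

@[simp] theorem zeroSumExt_succ (t : Fin n → ℤ) (i : Fin n) : zeroSumExt t i.succ = t i := rfl

theorem zeroSumExt_add (s t : Fin n → ℤ) : zeroSumExt (s + t) = zeroSumExt s + zeroSumExt t := by
  ext i
  refine Fin.cases ?_ (fun i => ?_) i
  · simp [Finset.sum_add_distrib, add_comm]
  · simp

theorem zeroSumExt_smul (a : ℤ) (t : Fin n → ℤ) : zeroSumExt (a • t) = a • zeroSumExt t := by
  ext i
  refine Fin.cases ?_ (fun i => ?_) i
  · simp [Finset.mul_sum]
  · simp

theorem zeroSumExt_zero : zeroSumExt (0 : Fin n → ℤ) = 0 := by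
  simpa using zeroSumExt_smul 0 (0 : Fin n → ℤ)

theorem sum_zeroSumExt (t : Fin n → ℤ) : ∑ i, zeroSumExt t i = 0 := by
  simp [Fin.sum_univ_succ]

theorem abs_zeroSumExt_le {N : ℤ} (hn : 1 ≤ n) (t : Fin n → ℤ) (ht : ∀ i, 0 ≤ t i ∧ t i ≤ N)
    (i : Fin (n + 1)) : |zeroSumExt t i| ≤ n * N := by
  have hN : 0 ≤ N := (ht ⟨0, hn⟩).1.trans (ht ⟨0, hn⟩).2
  refine Fin.cases ?_ (fun i => ?_) i
  · rw [zeroSumExt_zero_apply, abs_neg, abs_of_nonneg (Finset.sum_nonneg fun i _ => (ht i).1)]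
    simpa using Finset.sum_le_card_nsmul Finset.univ t N fun i _ => (ht i).2
  · rw [zeroSumExt_succ, abs_of_nonneg (ht i).1]
    have : (1 : ℤ) ≤ n := by exact_mod_cast hn
    nlinarith [(ht i).2]

end ZeroSumExt

/-- The average cost of a vector with sum zero and otherwise uniform entries in `[0, 2 ^ W)`. -/
noncomputable def meanCost (n W : ℕ) : ℝ := boxMean n (2 ^ W) fun t => (cost (zeroSumExt t) : ℝ)

theorem meanCost_nonneg (n W : ℕ) : 0 ≤ meanCost n W :=
  Finset.expect_nonneg fun _ _ => Nat.cast_nonneg _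

/-- The low `a` bits and the high `b` bits can be cleared one after the other. -/
theorem subadditive_meanCost (n : ℕ) : Subadditive (meanCost n) := by
  intro a b
  have h : meanCost n (a + b) ≤ boxMean n (2 ^ a) fun u => boxMean n (2 ^ b) fun v =>
      (cost (zeroSumExt u) : ℝ) + cost (zeroSumExt v) := by
    unfold meanCost
    rw [show 2 ^ (a + b) = 2 ^ b * 2 ^ a by ring, boxMean_mul]
    refine boxMean_mono fun u _ => boxMean_mono fun v _ => ?_
    rw [zeroSumExt_add, zeroSumExt_smul]
    have h1 := cost_add_le (zeroSumExt u) (((2 ^ a : ℕ) : ℤ) • zeroSumExt v)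
    have h2 := cost_two_pow_smul_le a (zeroSumExt v)
    push_cast at h1
    exact_mod_cast h1.trans (Nat.add_le_add_left h2 _)
  refine h.trans_eq ?_
  simp only [boxMean_add, boxMean_const]
  rfl

/-- The limit of `meanCost n W / W`. -/
noncomputable def meanCostRate (n : ℕ) : ℝ := (subadditive_meanCost n).lim

theorem tendsto_meanCost_div (n : ℕ) :
    Tendsto (fun W : ℕ => meanCost n W / W) atTop (𝓝 (meanCostRate n)) := by
  refine (subadditive_meanCost n).tendsto_lim ⟨0, ?_⟩
  rintro _ ⟨W, rfl⟩
  exact div_nonneg (meanCost_nonneg n W) (Nat.cast_nonneg W)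

/-! ### The lower bound for the rate -/

/-- A transaction changes the weight of at most two targets, each by a power of two. -/
theorem sum_weight_le_two_mul_cost {k : ℕ} (x : Fin k → ℤ) : ∑ i, weight (x i) ≤ 2 * cost x := by
  refine le_mul_wordLength (closure_moves k) (φ := fun x => ∑ i, weight (x i)) 2
    (by simp [wordLength_zero]) ?_ x
  rintro _ ⟨t, rfl⟩ x
  have h1 (i : Fin k) : weight ((t.removed + x) i) ≤ weight (x i) +
      ((if i.succ = t.src then 1 else 0) + if i.succ = t.dst then 1 else 0) := by
    have h := weight_add_le (t.removed i) (x i)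
    have h2 := weight_two_pow t.level
    have h3 := weight_neg (2 ^ t.level)
    have h4 : weight 0 = 0 := wordLength_zero
    simp only [Transaction.removed, Pi.add_apply] at h ⊢
    split_ifs at h ⊢ <;> omega
  have h2 (j : Fin (k + 1)) : ∑ i : Fin k, (if i.succ = j then 1 else 0) ≤ 1 := by
    rw [← Finset.card_filter]
    refine Finset.card_le_one.2 fun a ha b hb => Fin.succ_injective _ ?_
    rw [(Finset.mem_filter.1 ha).2, (Finset.mem_filter.1 hb).2]
  refine (Finset.sum_le_sum fun i _ => h1 i).trans ?_
  rw [Finset.sum_add_distrib, Finset.sum_add_distrib]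
  have := h2 t.src
  have := h2 t.dst
  omega

theorem weight_natCast_le (m : ℕ) : weight (m : ℤ) ≤ m := by
  induction m with
  | zero => simp [wordLength_zero]
  | succ m ih =>
    have := weight_add_one_le m
    push_cast
    omega

theorem sum_range_add_of_periodic (f : ℕ → ℕ) (N : ℕ) (hf : ∀ x, f (N + x) = f x) (c : ℕ) :
    ∑ a ∈ Finset.range N, f (a + c) = ∑ a ∈ Finset.range N, f a := by
  induction c with
  | zero => rfl
  | succ c ih =>
    have h1 := Finset.sum_range_succ (fun a => f (a + c)) N
    have h2 := Finset.sum_range_succ' (fun a => f (a + c)) N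
    simp only [hf, zero_add, add_right_comm _ 1 c] at h1 h2
    simp only [← add_assoc]
    omega

/-- Translating the interval `[0, 2 ^ W)` by `c` hardly decreases the total weight. -/
theorem sum_weight_le_sum_weight_add (W c B : ℕ) (hc : c ≤ B * 2 ^ W) :
    ∑ a ∈ Finset.range (2 ^ W), weight (a : ℤ) ≤
      ∑ a ∈ Finset.range (2 ^ W), weight ((a + c : ℕ) : ℤ) + 2 ^ W * (B + 1) := by
  have h1 := sum_range_add_of_periodic (fun x => weight ((x % 2 ^ W : ℕ) : ℤ)) (2 ^ W)
    (fun x => by simp) c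
  have h2 : ∑ a ∈ Finset.range (2 ^ W), weight ((a % 2 ^ W : ℕ) : ℤ) =
      ∑ a ∈ Finset.range (2 ^ W), weight (a : ℤ) :=
    Finset.sum_congr rfl fun a ha => by rw [Nat.mod_eq_of_lt (Finset.mem_range.1 ha)]
  rw [← h2, ← h1]
  have h3 : 2 ^ W * (B + 1) = ∑ a ∈ Finset.range (2 ^ W), (B + 1) := by simp
  rw [h3, ← Finset.sum_add_distrib]
  refine Finset.sum_le_sum fun a ha => ?_
  have hq : (a + c) / 2 ^ W ≤ B + 1 := by
    refine Nat.div_le_of_le_mul ?_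
    have := Finset.mem_range.1 ha
    rw [mul_comm, add_mul]
    omega
  have h4 : (((a + c) % 2 ^ W : ℕ) : ℤ) =
      ((a + c : ℕ) : ℤ) + -(2 ^ W * (((a + c) / 2 ^ W : ℕ) : ℤ)) := by
    have := Nat.mod_add_div (a + c) (2 ^ W)
    zify at this ⊢
    linarith
  have h5 := weight_add_le ((a + c : ℕ) : ℤ) (-(2 ^ W * (((a + c) / 2 ^ W : ℕ) : ℤ)))
  rw [← h4, weight_neg] at h5
  have h6 := weight_two_pow_mul_le W (((a + c) / 2 ^ W : ℕ) : ℤ)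
  have h7 := weight_natCast_le ((a + c) / 2 ^ W)
  omega

/-- The average weight over a translate of `[0, 2 ^ W)` is at least `W / 3 - O(1)`. -/
theorem le_expect_weight_add (W c B : ℕ) (hc : c ≤ B * 2 ^ W) :
    (W : ℝ) / 3 - (B + 2) ≤
      Finset.expect Finset.univ fun a : Fin (2 ^ W) => (weight ((a : ℕ) + c : ℤ) : ℝ) := by
  rw [Fintype.expect_eq_sum_div_card, Fintype.card_fin, le_div_iff₀ (by positivity)]
  have h1 := sum_weight_le_sum_weight_add W c B hc
  rw [← Nat.cast_le (α := ℝ), sum_weight_range_two_pow] at h1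
  rw [Fin.sum_univ_eq_sum_range (fun a : ℕ => (weight ((a : ℤ) + c) : ℝ))]
  push_cast at h1 ⊢
  have h2 : (1 : ℝ) ≤ 2 ^ W := one_le_pow₀ (by norm_num)
  have h3 : (-1 : ℝ) ≤ (-1) ^ W := by
    rcases neg_one_pow_eq_or ℝ W with h | h <;> rw [h]
    norm_num
  nlinarith

theorem le_boxMean_weight_zeroSumExt {n : ℕ} (hn : 1 ≤ n) (W : ℕ) (i : Fin (n + 1)) :
    (W : ℝ) / 3 - (n + 2) ≤
      boxMean n (2 ^ W) fun t => (weight (zeroSumExt t i) : ℝ) := by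
  rw [← boxMean_const (n := n) (N := 2 ^ W) ((W : ℝ) / 3 - (n + 2))]
  refine Fin.cases ?_ (fun i => ?_) i
  · rw [boxMean_eq_boxMean_line (⟨0, hn⟩ : Fin n) fun t => (weight (zeroSumExt t 0) : ℝ)]
    refine boxMean_mono fun u hu => ?_
    have hnn : 0 ≤ ∑ j ∈ Finset.univ \ {(⟨0, hn⟩ : Fin n)}, u j :=
      Finset.sum_nonneg fun j _ => (hu j).1
    obtain ⟨c, hc⟩ := Int.eq_ofNat_of_zero_le hnn
    have hcB : c ≤ n * 2 ^ W := by
      have h1 : ∑ j ∈ Finset.univ \ {(⟨0, hn⟩ : Fin n)}, u j ≤ ∑ j, u j :=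
        Finset.sum_le_sum_of_subset_of_nonneg (Finset.sdiff_subset) fun j _ _ => (hu j).1
      have h2 := Finset.sum_le_card_nsmul Finset.univ u (2 ^ W) fun j _ => by
        simpa using (hu j).2.le
      rw [hc] at h1
      have h3 := h1.trans h2
      simp only [Finset.card_univ, Fintype.card_fin, nsmul_eq_mul] at h3
      exact_mod_cast h3
    refine (le_expect_weight_add W c n hcB).trans_eq (Finset.expect_congr rfl fun a _ => ?_)
    rw [zeroSumExt_zero_apply, weight_neg, Finset.sum_update_of_mem (Finset.mem_univ _), hc]
  · rw [boxMean_eq_boxMean_line i fun t => (weight (zeroSumExt t i.succ) : ℝ)]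
    refine boxMean_mono fun u hu => ?_
    refine (le_expect_weight_add W 0 n (Nat.zero_le _)).trans_eq
      (Finset.expect_congr rfl fun a _ => ?_)
    simp

theorem le_meanCost {n : ℕ} (hn : 1 ≤ n) (W : ℕ) :
    (n + 1 : ℝ) / 6 * W - (n + 1) * (n + 2) / 2 ≤ meanCost n W := by
  have h1 : ∑ i : Fin (n + 1), ((W : ℝ) / 3 - (n + 2)) ≤ 2 * meanCost n W := by
    refine (Finset.sum_le_sum fun i _ => le_boxMean_weight_zeroSumExt hn W i).trans ?_
    rw [← boxMean_sum, meanCost, ← boxMean_mul_left]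
    refine boxMean_mono fun t _ => ?_
    exact_mod_cast sum_weight_le_two_mul_cost (zeroSumExt t)
  simp only [Finset.sum_const, Finset.card_univ, Fintype.card_fin, nsmul_eq_mul] at h1
  push_cast at h1
  linarith

/-- For two targets it suffices to write the first weight as a sum of signed powers of two. -/
theorem meanCost_one_le (W : ℕ) : meanCost 1 W ≤ W / 3 + 1 := by
  have h : meanCost 1 W ≤ boxMean 1 (2 ^ W) fun t => (weight (t 0) : ℝ) := by
    refine boxMean_mono fun t _ => ?_
    let f : ℤ →+ (Fin 2 → ℤ) :=
      AddMonoidHom.single (fun _ : Fin 2 => ℤ) 1 - AddMonoidHom.single (fun _ : Fin 2 => ℤ) 0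
    have hf : zeroSumExt t = f (t 0) := by
      ext i
      fin_cases i <;> simp [f, zeroSumExt]
    rw [hf]
    refine Nat.cast_le.2 (wordLength_map_le closure_signedPowers (closure_moves 2) f ?_ _)
    rintro _ ⟨l, rfl | rfl⟩
    · exact single_sub_single_mem_moves (by decide) l
    · rw [map_neg]
      exact neg_mem_moves (single_sub_single_mem_moves (by decide) l)
  refine h.trans ?_
  rw [boxMean_eq_boxMean_line 0]
  simp only [Function.update_self]
  rw [boxMean_const, Fintype.expect_eq_sum_div_card, Fintype.card_fin,
    Fin.sum_univ_eq_sum_range (fun a : ℕ => (weight (a : ℤ) : ℝ)), div_le_iff₀ (by positivity)]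
  have h1 := sum_weight_range_two_pow W
  push_cast at h1 ⊢
  rw [h1]
  have h2 : (1 : ℝ) ≤ 2 ^ W := one_le_pow₀ (by norm_num)
  have h3 : (-1 : ℝ) ^ W ≤ 1 := by
    rcases neg_one_pow_eq_or ℝ W with h | h <;> rw [h]
    norm_num
  nlinarith

/-! ### The upper bound for the rate -/

/-- The real indicator of the odd integers. -/
noncomputable def oddInd (z : ℤ) : ℝ := if Odd z then 1 else 0

theorem oddInd_add_oddInd_add_of_odd (z : ℤ) {d : ℤ} (hd : Odd d) :
    oddInd z + oddInd (z + d) = 1 := by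
  unfold oddInd
  by_cases hz : Odd z
  · rw [if_pos hz, if_neg (Int.not_odd_iff_even.2 (hz.add_odd hd)), add_zero]
  · rw [if_neg hz, if_pos ((Int.not_odd_iff_even.1 hz).add_odd hd), zero_add]

/-- A fair bit that enters an integer with an odd coefficient makes its parity fair. -/
theorem boxMean_oddInd {n : ℕ} (g : (Fin n → ℤ) → ℤ) (hadd : ∀ s t, g (s + t) = g s + g t)
    (l : Fin n) (hl : Odd (g (Pi.single l 1))) (e : ℤ) :
    boxMean n 2 (fun u => oddInd (e + g u)) = 1 / 2 := by
  rw [boxMean_eq_boxMean_line l, ← boxMean_const (n := n) (N := 2) (1 / 2 : ℝ)]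
  refine boxMean_congr fun u _ => ?_
  have h1 : Function.update u l 1 = Function.update u l 0 + Pi.single l 1 := by
    ext i
    rcases eq_or_ne i l with rfl | hi
    · simp
    · simp [hi]
  have h2 := oddInd_add_oddInd_add_of_odd (e + g (Function.update u l 0)) hl
  rw [add_assoc, ← hadd, ← h1] at h2
  rw [Fintype.expect_eq_sum_div_card, Fin.sum_univ_two]
  simp only [Fin.val_zero, Fin.val_one, Nat.cast_zero, Nat.cast_one, Fintype.card_fin]
  rw [h2]
  norm_num

theorem boxMean_oddInd_zeroSumExt {n : ℕ} (hn : 1 ≤ n) (i : Fin (n + 1)) (e : ℤ) :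
    boxMean n 2 (fun u => oddInd (e + zeroSumExt u i)) = 1 / 2 := by
  obtain ⟨l, hl⟩ : ∃ l : Fin n, Odd (zeroSumExt (Pi.single l 1) i) := by
    refine Fin.cases ⟨⟨0, hn⟩, ?_⟩ (fun i => ⟨i, ?_⟩) i <;> simp
  exact boxMean_oddInd (fun u => zeroSumExt u i) (fun s t => by simp [zeroSumExt_add]) l hl e

/-- With at least three targets, the parities of two entries are independent. -/
theorem boxMean_oddInd_zeroSumExt_add {n : ℕ} (hn : 2 ≤ n) {i j : Fin (n + 1)} (hij : i ≠ j)
    (e : ℤ) :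
    boxMean n 2 (fun u => oddInd (e + (zeroSumExt u i + zeroSumExt u j))) = 1 / 2 := by
  have : Nontrivial (Fin n) := Fin.nontrivial_iff_two_le.2 hn
  obtain ⟨l, hl⟩ : ∃ l : Fin n,
      Odd (zeroSumExt (Pi.single l 1) i + zeroSumExt (Pi.single l 1) j) := by
    obtain rfl | ⟨i, rfl⟩ := Fin.eq_zero_or_eq_succ i <;>
      obtain rfl | ⟨j, rfl⟩ := Fin.eq_zero_or_eq_succ j
    · exact absurd rfl hij
    · obtain ⟨l, hl⟩ := exists_ne j
      exact ⟨l, by simp [hl.symm]⟩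
    · obtain ⟨l, hl⟩ := exists_ne i
      exact ⟨l, by simp [hl.symm]⟩
    · have : j ≠ i := fun h => hij (by rw [h])
      exact ⟨i, by simp [this]⟩
  exact boxMean_oddInd (fun u => zeroSumExt u i + zeroSumExt u j)
    (fun s t => by simp [zeroSumExt_add]; ring) l hl e

/-- The entries of `c` in `O` are cleared to even numbers in pairs, by one unit transaction per
pair whose direction `τ` depends on the next bits `u`. If the next bits of the two entries differ,
both can be made divisible by four; if they agree, exactly one can. So on average a quarter of
the entries stays odd after halving. -/
theorem exists_pairing {n : ℕ} (hn : 2 ≤ n) (c : Fin (n + 1) → ℤ) (m : ℕ) :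
    ∀ O : Finset (Fin (n + 1)), O.card = 2 * m → (∀ i ∈ O, Odd (c i)) →
      ∃ τ : (Fin n → ℤ) → Fin (n + 1) → ℤ,
        (∀ u, (∀ i ∉ O, τ u i = 0) ∧ (∀ i ∈ O, τ u i = 1 ∨ τ u i = -1) ∧
          ∑ i, τ u i = 0 ∧ cost (τ u) ≤ m) ∧
        boxMean n 2 (fun u => ∑ i ∈ O, oddInd ((c i - τ u i) / 2 + zeroSumExt u i)) = m / 2 := by
  induction m with
  | zero =>
    intro O hO _
    have : O = ∅ := Finset.card_eq_zero.1 (by simpa using hO)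
    subst this
    exact ⟨fun _ => 0, fun u => ⟨by simp, by simp, by simp, by simp [wordLength_zero]⟩,
      by simp [boxMean_const]⟩
  | succ m ih =>
    intro O hO hodd
    obtain ⟨i, hi⟩ : O.Nonempty := Finset.card_pos.1 (by omega)
    obtain ⟨j, hj⟩ : (O.erase i).Nonempty :=
      Finset.card_pos.1 (by rw [Finset.card_erase_of_mem hi]; omega)
    have hij : i ≠ j := (Finset.ne_of_mem_erase hj).symm
    set O' := (O.erase i).erase j with hO'
    have hi' : i ∉ O' := by simp [hO']
    have hj' : j ∉ O' := by simp [hO']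
    have hcard : O'.card = 2 * m := by
      rw [hO', Finset.card_erase_of_mem hj, Finset.card_erase_of_mem hi]
      omega
    have hsub {a} (ha : a ∈ O') : a ∈ O := Finset.mem_of_mem_erase (Finset.mem_of_mem_erase ha)
    have hmem {a} (hai : a ≠ i) (haj : a ≠ j) : a ∈ O' ↔ a ∈ O := by simp [hO', hai, haj]
    obtain ⟨τ, hτ, hmean⟩ := ih O' hcard fun a ha => hodd a (hsub ha)
    -- The direction is chosen so that the entry `i` becomes divisible by four.
    let σ : (Fin n → ℤ) → ℤ := fun u => if Odd ((c i - 1) / 2 + zeroSumExt u i) then -1 else 1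
    have hσ (u) : σ u = 1 ∨ σ u = -1 := by
      by_cases h : Odd ((c i - 1) / 2 + zeroSumExt u i) <;> simp [σ, h]
    let τ' : (Fin n → ℤ) → Fin (n + 1) → ℤ :=
      fun u => τ u + σ u • (Pi.single i 1 - Pi.single j 1)
    have hτi (u) : τ' u i = σ u := by simp [τ', (hτ u).1 i hi', hij]
    have hτj (u) : τ' u j = -σ u := by simp [τ', (hτ u).1 j hj', hij.symm]
    have hτa (u) {a} (hai : a ≠ i) (haj : a ≠ j) : τ' u a = τ u a := by simp [τ', hai, haj]
    refine ⟨τ', fun u => ⟨fun a ha => ?_, fun a ha => ?_, ?_, ?_⟩, ?_⟩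
    · have hai : a ≠ i := fun h => ha (h ▸ hi)
      have haj : a ≠ j := fun h => ha (h ▸ Finset.mem_of_mem_erase hj)
      rw [hτa u hai haj]
      exact (hτ u).1 a fun h => ha (hsub h)
    · rcases eq_or_ne a i with rfl | hai
      · rw [hτi]
        exact hσ u
      rcases eq_or_ne a j with rfl | haj
      · rw [hτj]
        rcases hσ u with h | h <;> simp [h]
      rw [hτa u hai haj]
      exact (hτ u).2.1 a ((hmem hai haj).2 ha)
    · simp [τ', Finset.sum_add_distrib, (hτ u).2.2.1, ← Finset.mul_sum]
    · have h1 : cost (σ u • (Pi.single i 1 - Pi.single j 1 : Fin (n + 1) → ℤ)) ≤ 1 := by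
        have h2 := single_sub_single_mem_moves hij 0
        rw [pow_zero] at h2
        rcases hσ u with h | h
        · rw [h, one_smul]
          exact wordLength_le_one h2
        · rw [h, neg_one_smul]
          exact wordLength_le_one (neg_mem_moves h2)
      exact (cost_add_le _ _).trans (Nat.add_le_add (hτ u).2.2.2 h1)
    · have hO_eq : O = insert i (insert j O') := by
        rw [hO', Finset.insert_erase hj, Finset.insert_erase hi]
      have hpair (u : Fin n → ℤ) : oddInd ((c i - σ u) / 2 + zeroSumExt u i) +
          oddInd ((c j - -σ u) / 2 + zeroSumExt u j) =
          oddInd (((c i - 1) / 2 + (c j - 1) / 2 + 1) + (zeroSumExt u i + zeroSumExt u j)) := by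
        obtain ⟨a, ha⟩ := hodd i hi
        obtain ⟨b, hb⟩ := hodd j (Finset.mem_of_mem_erase hj)
        have e1 : (c i - 1) / 2 = a := by omega
        have e2 : (c j - 1) / 2 = b := by omega
        have e3 : (c i + 1) / 2 = a + 1 := by omega
        have e4 : (c j + 1) / 2 = b + 1 := by omega
        by_cases h : Odd (a + zeroSumExt u i)
        · have hs : σ u = -1 := by simp [σ, e1, h]
          rw [hs, neg_neg, sub_neg_eq_add, e1, e2, e3]
          unfold oddInd
          rw [if_neg (by simp only [Int.odd_iff] at h ⊢; omega), zero_add]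
          exact if_congr (by simp only [Int.odd_iff] at h ⊢; omega) rfl rfl
        · have hs : σ u = 1 := by simp [σ, e1, h]
          rw [hs, sub_neg_eq_add, e1, e2, e4]
          unfold oddInd
          rw [if_neg h, zero_add]
          exact if_congr (by simp only [Int.odd_iff] at h ⊢; omega) rfl rfl
      have hsum (u : Fin n → ℤ) :
          ∑ a ∈ O, oddInd ((c a - τ' u a) / 2 + zeroSumExt u a) =
          oddInd (((c i - 1) / 2 + (c j - 1) / 2 + 1) + (zeroSumExt u i + zeroSumExt u j)) +
          ∑ a ∈ O', oddInd ((c a - τ u a) / 2 + zeroSumExt u a) := by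
        rw [hO_eq, Finset.sum_insert (by simp [hij, hi']), Finset.sum_insert hj', ← add_assoc,
          hτi, hτj, hpair]
        congr 1
        refine Finset.sum_congr rfl fun a ha => ?_
        rw [hτa u (fun h => hi' (h ▸ ha)) (fun h => hj' (h ▸ ha))]
      simp only [hsum]
      rw [boxMean_add, boxMean_oddInd_zeroSumExt_add hn hij, hmean]
      push_cast
      ring

theorem even_card_filter_odd {ι : Type*} [Fintype ι] (c : ι → ℤ) (hc : ∑ i, c i = 0) :
    Even (Finset.univ.filter fun i => Odd (c i)).card := by
  have h1 : Even (∑ i, (c i - if Odd (c i) then 1 else 0)) := by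
    refine Finset.even_sum _ fun i _ => ?_
    by_cases h : Odd (c i)
    · rw [if_pos h]
      exact h.sub_odd odd_one
    · rw [if_neg h, sub_zero]
      exact Int.not_odd_iff_even.1 h
  rw [Finset.sum_sub_distrib, hc, zero_sub, even_neg, Finset.sum_boole] at h1
  exact_mod_cast h1

/-- Clearing the lowest bits of `c` by `τ`, for `u` the next bits, leaves twice a vector of the
same kind with, on average, `(n + 1) / 2 - m / 4` odd entries, where `m` is the number of
odd entries of `c`. -/
theorem exists_halving {n : ℕ} (hn : 2 ≤ n) (c : Fin (n + 1) → ℤ) (hc : ∑ i, c i = 0)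
    (hb : ∀ i, |c i| ≤ 2 * n + 1) :
    ∃ τ d : (Fin n → ℤ) → Fin (n + 1) → ℤ,
      (∀ u, (∀ i, 0 ≤ u i ∧ u i < ((2 : ℕ) : ℤ)) → c + (2 : ℤ) • zeroSumExt u = τ u + (2 : ℤ) • d u ∧
        (cost (τ u) : ℝ) ≤ (∑ i, oddInd (c i)) / 2 ∧
        ∑ i, d u i = 0 ∧ ∀ i, |d u i| ≤ 2 * n + 1) ∧
      boxMean n 2 (fun u => ∑ i, oddInd (d u i)) = (n + 1) / 2 - (∑ i, oddInd (c i)) / 4 := by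
  classical
  set O := Finset.univ.filter fun i => Odd (c i) with hO
  obtain ⟨m, hm⟩ := even_card_filter_odd c hc
  rw [← hO, ← two_mul] at hm
  obtain ⟨τ, hτ, hmean⟩ := exists_pairing hn c m O hm fun i hi => (Finset.mem_filter.1 hi).2
  have hodd : ∑ i, oddInd (c i) = 2 * m := by
    unfold oddInd
    rw [Finset.sum_boole, ← hO, hm]
    push_cast
    rfl
  have hdiv (u : Fin n → ℤ) (i : Fin (n + 1)) : 2 * ((c i - τ u i) / 2) = c i - τ u i := by
    by_cases hi : i ∈ O
    · have h1 := Int.odd_iff.1 (Finset.mem_filter.1 hi).2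
      rcases (hτ u).2.1 i hi with h | h <;> omega
    · have h1 : ¬ Odd (c i) := fun h => hi (Finset.mem_filter.2 ⟨Finset.mem_univ i, h⟩)
      rw [Int.odd_iff] at h1
      have := (hτ u).1 i hi
      omega
  have habs (u : Fin n → ℤ) (i : Fin (n + 1)) : |τ u i| ≤ 1 := by
    by_cases hi : i ∈ O
    · rcases (hτ u).2.1 i hi with h | h <;> simp [h]
    · simp [(hτ u).1 i hi]
  refine ⟨τ, fun u i => (c i - τ u i) / 2 + zeroSumExt u i,
    fun u hu => ⟨?_, ?_, ?_, fun i => ?_⟩, ?_⟩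
  · ext i
    have := hdiv u i
    simp only [Pi.add_apply, Pi.smul_apply, smul_eq_mul]
    linarith
  · rw [hodd, mul_div_cancel_left₀ _ two_ne_zero]
    exact_mod_cast (hτ u).2.2.2
  · rw [Finset.sum_add_distrib, sum_zeroSumExt, add_zero]
    have h1 : 2 * ∑ i, (c i - τ u i) / 2 = 0 := by
      rw [Finset.mul_sum, Finset.sum_congr rfl fun i _ => hdiv u i, Finset.sum_sub_distrib, hc,
        (hτ u).2.2.1, sub_zero]
    omega
  · have h1 := hdiv u i
    have h2 := habs u i
    have h3 := hb i
    have h4 := abs_zeroSumExt_le (N := 1) (by omega) u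
      (fun i => ⟨(hu i).1, by have := (hu i).2; push_cast at this; omega⟩) i
    rw [abs_le] at h2 h3 h4 ⊢
    dsimp only
    constructor <;> omega
  · have hsplit (u : Fin n → ℤ) :
        ∑ i, oddInd ((c i - τ u i) / 2 + zeroSumExt u i) =
        ∑ i ∈ O, oddInd ((c i - τ u i) / 2 + zeroSumExt u i) +
        ∑ i ∈ Oᶜ, oddInd (c i / 2 + zeroSumExt u i) := by
      rw [← Finset.sum_add_sum_compl O]
      congr 1
      refine Finset.sum_congr rfl fun i hi => ?_
      rw [(hτ u).1 i (Finset.mem_compl.1 hi), sub_zero]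
    simp only [hsplit]
    rw [boxMean_add, hmean, boxMean_sum,
      Finset.sum_congr rfl fun i _ => boxMean_oddInd_zeroSumExt (by omega) i (c i / 2),
      Finset.sum_const, nsmul_eq_mul, Finset.card_compl, hm, Fintype.card_fin, hodd,
      Nat.cast_sub (by simpa [hm] using Finset.card_le_univ O)]
    push_cast
    ring

/-- The potential `2 / 5 * (number of odd entries)` makes every bit cost `(n + 1) / 5`. -/
theorem exists_boxMean_cost_le {n : ℕ} (hn : 2 ≤ n) :
    ∃ C : ℝ, ∀ (W : ℕ) (c : Fin (n + 1) → ℤ), ∑ i, c i = 0 → (∀ i, |c i| ≤ 2 * n + 1) →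
      boxMean n (2 ^ W) (fun t => (cost (c + (2 : ℤ) • zeroSumExt t) : ℝ)) ≤
        (n + 1) / 5 * W + 2 / 5 * ∑ i, oddInd (c i) + C := by
  obtain ⟨C, hC⟩ := exists_cost_le (k := n + 1) (2 * n + 1)
  have hnn (c : Fin (n + 1) → ℤ) : 0 ≤ ∑ i, oddInd (c i) :=
    Finset.sum_nonneg fun i _ => by unfold oddInd; positivity
  refine ⟨C, fun W => ?_⟩
  induction W with
  | zero =>
    intro c _ hb
    have h1 : (cost c : ℝ) ≤ C := Nat.cast_le.2 (hC c hb)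
    have h2 := hnn c
    rw [pow_zero, boxMean_one, zeroSumExt_zero, smul_zero, add_zero]
    push_cast
    linarith
  | succ W ih =>
    intro c hc hb
    obtain ⟨τ, d, h, hmean⟩ := exists_halving hn c hc hb
    rw [pow_succ, boxMean_mul]
    have key : boxMean n 2 (fun u => boxMean n (2 ^ W) fun v =>
        (cost (c + (2 : ℤ) • zeroSumExt (u + ((2 : ℕ) : ℤ) • v)) : ℝ)) ≤
        boxMean n 2 fun u => ((∑ i, oddInd (c i)) / 2 + (n + 1) / 5 * W + C) +
          2 / 5 * ∑ i, oddInd (d u i) := by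
      refine boxMean_mono fun u hu => ?_
      obtain ⟨h1, h2, h3, h4⟩ := h u hu
      have h5 : boxMean n (2 ^ W) (fun v =>
          (cost (c + (2 : ℤ) • zeroSumExt (u + ((2 : ℕ) : ℤ) • v)) : ℝ)) ≤
          boxMean n (2 ^ W) fun v =>
            (cost (τ u) : ℝ) + cost (d u + (2 : ℤ) • zeroSumExt v) := by
        refine boxMean_mono fun v _ => ?_
        have e : c + (2 : ℤ) • zeroSumExt (u + ((2 : ℕ) : ℤ) • v) =
            τ u + (2 : ℤ) • (d u + (2 : ℤ) • zeroSumExt v) := by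
          rw [zeroSumExt_add, zeroSumExt_smul, smul_add, ← add_assoc, h1, smul_add, add_assoc]
          rfl
        rw [e]
        exact_mod_cast (cost_add_le _ _).trans (Nat.add_le_add_left (cost_two_smul_le _) _)
      rw [boxMean_add, boxMean_const] at h5
      have h6 := ih (d u) h3 h4
      refine h5.trans ?_
      linarith
    refine key.trans ?_
    rw [boxMean_add, boxMean_const, boxMean_mul_left, hmean]
    push_cast
    linarith

theorem exists_meanCost_succ_le {n : ℕ} (hn : 2 ≤ n) :
    ∃ C : ℝ, ∀ W : ℕ, meanCost n (W + 1) ≤ (n + 1) / 5 * W + C := by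
  obtain ⟨C, hC⟩ := exists_boxMean_cost_le hn
  refine ⟨2 / 5 * (n + 1) + C, fun W => ?_⟩
  unfold meanCost
  rw [pow_succ, boxMean_mul]
  rw [← boxMean_const (n := n) (N := 2) ((n + 1) / 5 * W + (2 / 5 * (n + 1) + C) : ℝ)]
  refine boxMean_mono fun u hu => ?_
  have h1 := hC W (zeroSumExt u) (sum_zeroSumExt u) fun i => by
    have h4 := abs_zeroSumExt_le (N := 1) (by omega) u
      (fun i => ⟨(hu i).1, by have := (hu i).2; push_cast at this; omega⟩) i
    omega
  have h2 : ∑ i, oddInd (zeroSumExt u i) ≤ (n + 1 : ℝ) := by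
    have := Finset.sum_le_card_nsmul Finset.univ (fun i => oddInd (zeroSumExt u i)) 1
      fun i _ => by unfold oddInd; split_ifs <;> norm_num
    simpa using this
  simp only [zeroSumExt_add, zeroSumExt_smul]
  refine h1.trans ?_
  linarith

theorem meanCostRate_ge {n : ℕ} (hn : 1 ≤ n) : (n + 1 : ℝ) / 6 ≤ meanCostRate n := by
  have h1 : Tendsto (fun W : ℕ => (n + 1 : ℝ) / 6 - (n + 1) * (n + 2) / 2 / W) atTop
      (𝓝 ((n + 1 : ℝ) / 6 - 0)) :=
    tendsto_const_nhds.sub (tendsto_const_div_atTop_nhds_zero_nat _)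
  rw [sub_zero] at h1
  refine le_of_tendsto_of_tendsto h1 (tendsto_meanCost_div n) ?_
  filter_upwards [eventually_gt_atTop 0] with W hW
  have hW' : (0 : ℝ) < W := Nat.cast_pos.2 hW
  rw [le_div_iff₀ hW', sub_mul, div_mul_cancel₀ _ hW'.ne']
  exact le_meanCost hn W

theorem meanCostRate_one_le : meanCostRate 1 ≤ 1 / 3 := by
  have h1 : Tendsto (fun W : ℕ => (1 : ℝ) / 3 + 1 / W) atTop (𝓝 (1 / 3 + 0)) :=
    tendsto_const_nhds.add (tendsto_const_div_atTop_nhds_zero_nat _)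
  rw [add_zero] at h1
  refine le_of_tendsto_of_tendsto (tendsto_meanCost_div 1) h1 ?_
  filter_upwards [eventually_gt_atTop 0] with W hW
  have hW' : (0 : ℝ) < W := Nat.cast_pos.2 hW
  rw [div_le_iff₀ hW', add_mul, div_mul_cancel₀ _ hW'.ne']
  linarith [meanCost_one_le W]

theorem meanCostRate_le {n : ℕ} (hn : 1 ≤ n) : meanCostRate n ≤ (n + 1) / 5 := by
  obtain rfl | hn2 := hn.eq_or_lt
  · refine meanCostRate_one_le.trans ?_
    norm_num
  obtain ⟨C, hC⟩ := exists_meanCost_succ_le hn2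
  have h1 : Tendsto (fun W : ℕ => (n + 1 : ℝ) / 5 + C / ((W + 1 : ℕ) : ℝ)) atTop
      (𝓝 ((n + 1) / 5 + 0)) :=
    tendsto_const_nhds.add
      ((tendsto_const_div_atTop_nhds_zero_nat C).comp (tendsto_add_atTop_nat 1))
  rw [add_zero] at h1
  refine le_of_tendsto_of_tendsto ((tendsto_meanCost_div n).comp (tendsto_add_atTop_nat 1)) h1 ?_
  refine Eventually.of_forall fun W => ?_
  have hW' : (0 : ℝ) < ((W + 1 : ℕ) : ℝ) := Nat.cast_pos.2 W.succ_pos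
  simp only [Function.comp_apply]
  rw [div_le_iff₀ hW', add_mul, div_mul_cancel₀ _ hW'.ne']
  have := hC W
  have hn0 : (0 : ℝ) ≤ n := Nat.cast_nonneg n
  push_cast
  nlinarith

/-! ### From boxes to ordered partitions -/

/-- The number of points of a simplex: of `n + 1` natural numbers with sum `m`. -/
def simplexCard (n m : ℕ) : ℕ := (Finset.piAntidiag (Finset.univ : Finset (Fin (n + 1))) m).card

theorem simplexCard_eq_choose (n m : ℕ) : simplexCard n m = (m + n).choose n := by
  rw [simplexCard, ← Finset.map_sym_eq_piAntidiag, Finset.card_map, Finset.sym_univ,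
    Finset.card_univ, Sym.card_sym_eq_choose, Fintype.card_fin, add_right_comm,
    Nat.add_sub_cancel, add_comm n m]
  exact Nat.choose_symm_add

theorem simplexCard_pos (n m : ℕ) : 0 < simplexCard n m := by
  rw [simplexCard_eq_choose]
  exact Nat.choose_pos (Nat.le_add_left n m)

theorem isEquivalent_choose_add (n a : ℕ) :
    Asymptotics.IsEquivalent atTop (fun m : ℕ => (((m + a).choose n : ℕ) : ℝ))
      fun m : ℕ => (m : ℝ) ^ n / n.factorial := by
  have h1 := (isEquivalent_choose n).comp_tendsto (tendsto_add_atTop_nat a)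
  refine h1.trans (Asymptotics.IsEquivalent.symm ?_)
  have h2 : Tendsto (fun m : ℕ => ((m : ℝ) / (m + a)) ^ n) atTop (𝓝 (1 ^ n)) :=
    (tendsto_natCast_div_add_atTop (a : ℝ)).pow n
  rw [one_pow] at h2
  refine Asymptotics.isEquivalent_of_tendsto_one (h2.congr' ?_)
  filter_upwards with m
  have hn : (n.factorial : ℝ) ≠ 0 := Nat.cast_ne_zero.2 n.factorial_ne_zero
  simp only [Function.comp_apply, Pi.div_apply]
  rw [div_div_div_cancel_right₀ hn, div_pow]
  push_cast
  rfl

theorem tendsto_simplexCard_div (n c : ℕ) :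
    Tendsto (fun m => (simplexCard n (m + c) : ℝ) / simplexCard n m) atTop (𝓝 1) := by
  have h := (isEquivalent_choose_add n (c + n)).trans (isEquivalent_choose_add n n).symm
  rw [Asymptotics.isEquivalent_iff_tendsto_one] at h
  · simp only [simplexCard_eq_choose, add_assoc]
    exact h
  · filter_upwards with m
    exact Nat.cast_ne_zero.2 (Nat.choose_pos (Nat.le_add_left n m)).ne'

/-- The residues modulo `2 ^ m` of all weights but the first. -/
def tailResidues {n : ℕ} (m : ℕ) (P : Fin (n + 1) → ℕ) (i : Fin n) : Fin (2 ^ m) :=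
  ⟨P i.succ % 2 ^ m, Nat.mod_lt _ (by positivity)⟩

section Fibers

variable {n : ℕ}

theorem sum_succ_eq {W : ℕ} {P : Fin (n + 1) → ℕ} (hP : P ∈ orderedPartitions (n + 1) W) :
    P 0 + ∑ i : Fin n, P i.succ = 2 ^ W := by
  rw [← (mem_orderedPartitions.1 hP).2, Fin.sum_univ_succ]

/-- The quotients modulo `2 ^ m` of the partitions with given residues fit into a simplex. -/
theorem card_fiber_le (m j : ℕ) (r : Fin n → Fin (2 ^ m)) :
    ((orderedPartitions (n + 1) (m + j)).filter fun P => tailResidues m P = r).card ≤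
      simplexCard n (2 ^ j - 1) := by
  refine Finset.card_le_card_of_injOn
    (fun P => Fin.cons (2 ^ j - 1 - ∑ i : Fin n, P i.succ / 2 ^ m) fun i => P i.succ / 2 ^ m)
    ?_ ?_
  · intro P hP
    obtain ⟨hP, -⟩ := Finset.mem_filter.1 (Finset.mem_coe.1 hP)
    have h0 := (mem_orderedPartitions.1 hP).1 0
    have hs := sum_succ_eq hP
    have h1 : 2 ^ m * ∑ i : Fin n, P i.succ / 2 ^ m ≤ ∑ i : Fin n, P i.succ := by
      rw [Finset.mul_sum]
      exact Finset.sum_le_sum fun i _ => Nat.mul_div_le _ _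
    have h2 : 2 ^ m * ∑ i : Fin n, P i.succ / 2 ^ m < 2 ^ m * 2 ^ j := by
      rw [← pow_add]
      omega
    have h3 := Nat.lt_of_mul_lt_mul_left h2
    refine Finset.mem_coe.2 (Finset.mem_piAntidiag.2 ⟨?_, fun i _ => Finset.mem_univ i⟩)
    rw [Fin.sum_univ_succ]
    simp only [Fin.cons_zero, Fin.cons_succ]
    omega
  · intro P hP Q hQ hPQ
    obtain ⟨hP, hPr⟩ := Finset.mem_filter.1 (Finset.mem_coe.1 hP)
    obtain ⟨hQ, hQr⟩ := Finset.mem_filter.1 (Finset.mem_coe.1 hQ)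
    have htail (i : Fin n) : P i.succ = Q i.succ := by
      have h1 : P i.succ / 2 ^ m = Q i.succ / 2 ^ m := by simpa using congrFun hPQ i.succ
      have h2 : P i.succ % 2 ^ m = Q i.succ % 2 ^ m :=
        congrArg Fin.val (congrFun (hPr.trans hQr.symm) i)
      rw [← Nat.mod_add_div (P i.succ) (2 ^ m), h1, h2, Nat.mod_add_div]
    have h1 := sum_succ_eq hP
    have h2 := sum_succ_eq hQ
    rw [Finset.sum_congr rfl fun i _ => htail i] at h1
    ext i
    refine Fin.cases ?_ htail i
    omega

/-- Conversely all residues extend to partitions with any quotients from a slightly smaller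
simplex. -/
theorem le_card_fiber (m j : ℕ) (hj : 2 * n + 1 ≤ 2 ^ j) (r : Fin n → Fin (2 ^ m)) :
    simplexCard n (2 ^ j - (2 * n + 1)) ≤
      ((orderedPartitions (n + 1) (m + j)).filter fun P => tailResidues m P = r).card := by
  have hM : 0 < 2 ^ m := by positivity
  refine Finset.card_le_card_of_injOn
    (fun v => Fin.cons (2 ^ (m + j) - ∑ i : Fin n, ((r i : ℕ) + 2 ^ m * (v i.succ + 1)))
      fun i => (r i : ℕ) + 2 ^ m * (v i.succ + 1)) ?_ ?_
  · intro v hv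
    have hsum : ∑ i, v i = 2 ^ j - (2 * n + 1) := by simpa using hv
    rw [Fin.sum_univ_succ] at hsum
    have h1 : ∑ i : Fin n, ((r i : ℕ) + 2 ^ m * (v i.succ + 1)) ≤
        2 ^ m * ∑ i : Fin n, (v i.succ + 2) := by
      rw [Finset.mul_sum]
      refine Finset.sum_le_sum fun i _ => ?_
      have := (r i).isLt
      rw [mul_add, mul_add]
      omega
    have h2 : ∑ i : Fin n, (v i.succ + 2) < 2 ^ j := by
      rw [Finset.sum_add_distrib]
      simp only [Finset.sum_const, Finset.card_univ, Fintype.card_fin, smul_eq_mul]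
      omega
    have h3 := h1.trans_lt (Nat.mul_lt_mul_of_pos_left h2 hM)
    rw [← pow_add] at h3
    refine Finset.mem_coe.2 (Finset.mem_filter.2 ⟨mem_orderedPartitions.2 ⟨fun i => ?_, ?_⟩, ?_⟩)
    · refine Fin.cases ?_ (fun i => ?_) i
      · simp only [Fin.cons_zero]
        omega
      · simp only [Fin.cons_succ]
        positivity
    · simp only [Fin.sum_univ_succ, Fin.cons_zero, Fin.cons_succ]
      omega
    · ext i
      simp [tailResidues, Nat.mod_eq_of_lt (r i).isLt]
  · intro v hv w hw hvw
    have hv' : ∑ i, v i = 2 ^ j - (2 * n + 1) := by simpa using hv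
    have hw' : ∑ i, w i = 2 ^ j - (2 * n + 1) := by simpa using hw
    have htail (i : Fin n) : v i.succ = w i.succ := by
      have h := congrFun hvw i.succ
      simpa using h
    rw [Fin.sum_univ_succ] at hv' hw'
    rw [Finset.sum_congr rfl fun i _ => htail i] at hv'
    ext i
    refine Fin.cases ?_ htail i
    omega

/-- The complexity of a partition depends on the top `j` bits only up to a constant. -/
theorem exists_complexity_near (n j : ℕ) :
    ∃ C : ℕ, ∀ (m : ℕ), ∀ P ∈ orderedPartitions (n + 1) (m + j),
      complexity P ≤ cost (zeroSumExt fun i => ((tailResidues m P i : ℕ) : ℤ)) + C ∧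
      cost (zeroSumExt fun i => ((tailResidues m P i : ℕ) : ℤ)) ≤ complexity P + C := by
  obtain ⟨C, hC⟩ := exists_cost_le (k := n + 1) (n * 2 ^ j + 2 ^ j)
  refine ⟨C, fun m P hP => ?_⟩
  set u : Fin n → ℤ := fun i => ((tailResidues m P i : ℕ) : ℤ) with hu
  set v : Fin n → ℤ := fun i => ((P i.succ / 2 ^ m : ℕ) : ℤ) with hv
  have hs := sum_succ_eq hP
  have hdecomp : (fun i => (P i : ℤ)) =
      zeroSumExt u + (2 ^ m : ℤ) • (zeroSumExt v + Pi.single 0 (2 ^ j)) := by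
    have htail (i : Fin n) : (P i.succ : ℤ) = u i + 2 ^ m * v i := by
      have := Nat.mod_add_div (P i.succ) (2 ^ m)
      simp only [hu, hv, tailResidues]
      exact_mod_cast this.symm
    ext i
    refine Fin.cases ?_ (fun i => ?_) i
    · have h1 : (P 0 : ℤ) + ∑ i : Fin n, (P i.succ : ℤ) = 2 ^ m * 2 ^ j := by
        rw [← pow_add]
        exact_mod_cast hs
      simp only [htail, Finset.sum_add_distrib, ← Finset.mul_sum] at h1
      simp only [Pi.add_apply, Pi.smul_apply, zeroSumExt_zero_apply, Pi.single_eq_same,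
        smul_eq_mul]
      linarith
    · simp [htail]
  have hbound : cost ((2 ^ m : ℤ) • (zeroSumExt v + Pi.single 0 (2 ^ j))) ≤ C := by
    refine (cost_two_pow_smul_le m _).trans (hC _ fun i => ?_)
    have hv01 (i : Fin n) : 0 ≤ v i ∧ v i ≤ 2 ^ j := by
      refine ⟨Nat.cast_nonneg _, ?_⟩
      have h1 : P i.succ ≤ 2 ^ m * 2 ^ j := by
        rw [← pow_add, ← hs]
        exact (Finset.single_le_sum (f := fun i : Fin n => P i.succ) (fun i _ => Nat.zero_le _)
          (Finset.mem_univ i)).trans (Nat.le_add_left _ _)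
      have h2 := Nat.div_le_of_le_mul h1
      simp only [hv]
      exact_mod_cast h2
    have h1 : |zeroSumExt v i| ≤ n * 2 ^ j := by
      rcases Nat.eq_zero_or_pos n with rfl | hn
      · refine Fin.cases ?_ (fun i => i.elim0) i
        simp
      · exact abs_zeroSumExt_le hn v hv01 i
    have h2 : |(Pi.single 0 (2 ^ j) : Fin (n + 1) → ℤ) i| ≤ 2 ^ j := by
      rcases eq_or_ne i 0 with rfl | hi
      · simp
      · simp [hi]
    exact (abs_add_le _ _).trans (add_le_add h1 h2)
  rw [complexity_eq_wordLength, hdecomp]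
  exact ⟨(cost_add_le _ _).trans (Nat.add_le_add_left hbound _),
    (cost_le_add _ _).trans (Nat.add_le_add_left hbound _)⟩

/-- Up to a constant and a factor close to `1`, the expected complexity of a partition of
`2 ^ (m + j)` is the average cost over residues modulo `2 ^ m`, because all residues occur
almost equally often. -/
theorem exists_expectedComplexity_near (n j : ℕ) (hj : 2 * n + 1 ≤ 2 ^ j) :
    ∃ C : ℝ, ∀ m : ℕ,
      (simplexCard n (2 ^ j - (2 * n + 1)) / simplexCard n (2 ^ j - 1) : ℝ) * meanCost n m - C ≤
        expectedComplexity (n + 1) (m + j) ∧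
      expectedComplexity (n + 1) (m + j) ≤
        (simplexCard n (2 ^ j - 1) / simplexCard n (2 ^ j - (2 * n + 1)) : ℝ) * meanCost n m + C
      := by
  obtain ⟨C, hC⟩ := exists_complexity_near n j
  refine ⟨C, fun m => ?_⟩
  set S := orderedPartitions (n + 1) (m + j) with hS
  set A := simplexCard n (2 ^ j - (2 * n + 1)) with hA
  set B := simplexCard n (2 ^ j - 1) with hB
  have hA0 : (0 : ℝ) < A := Nat.cast_pos.2 (simplexCard_pos _ _)
  have hB0 : (0 : ℝ) < B := Nat.cast_pos.2 (simplexCard_pos _ _)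
  let f : (Fin n → Fin (2 ^ m)) → ℝ := fun r => cost (zeroSumExt fun i => ((r i : ℕ) : ℤ))
  have hf (r) : 0 ≤ f r := Nat.cast_nonneg _
  let N : ℝ := Fintype.card (Fin n → Fin (2 ^ m))
  have hN : 0 < N := Nat.cast_pos.2 Fintype.card_pos
  have hmean : ∑ r, f r = N * meanCost n m := by
    rw [meanCost, boxMean, Fintype.expect_eq_sum_div_card, mul_div_cancel₀ _ hN.ne']
  have hSsum : ∑ P ∈ S, f (tailResidues m P) =
      ∑ r, ((S.filter fun P => tailResidues m P = r).card : ℝ) * f r := by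
    rw [← Finset.sum_fiberwise S (tailResidues m)]
    refine Finset.sum_congr rfl fun r _ => ?_
    rw [← nsmul_eq_mul, ← Finset.sum_const]
    exact Finset.sum_congr rfl fun P hP => by rw [(Finset.mem_filter.1 hP).2]
  have hScard : (S.card : ℝ) = ∑ r, ((S.filter fun P => tailResidues m P = r).card : ℝ) := by
    rw [Finset.card_eq_sum_card_fiberwise (f := tailResidues m) (t := Finset.univ)
      (fun _ _ => Finset.mem_coe.2 (Finset.mem_univ _))]
    push_cast
    rfl
  have hlow (r) : (A : ℝ) ≤ (S.filter fun P => tailResidues m P = r).card :=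
    Nat.cast_le.2 (le_card_fiber m j hj r)
  have hupp (r) : ((S.filter fun P => tailResidues m P = r).card : ℝ) ≤ B :=
    Nat.cast_le.2 (card_fiber_le m j r)
  have hcard_le : (S.card : ℝ) ≤ B * N := by
    rw [hScard]
    refine (Finset.sum_le_sum fun r _ => hupp r).trans_eq ?_
    simp [N, mul_comm]
  have hle_card : A * N ≤ S.card := by
    rw [hScard]
    refine Eq.trans_le ?_ (Finset.sum_le_sum fun r _ => hlow r)
    simp [N, mul_comm]
  have hsum_le : ∑ P ∈ S, f (tailResidues m P) ≤ B * (N * meanCost n m) := by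
    rw [hSsum, ← hmean, Finset.mul_sum]
    exact Finset.sum_le_sum fun r _ => mul_le_mul_of_nonneg_right (hupp r) (hf r)
  have hle_sum : A * (N * meanCost n m) ≤ ∑ P ∈ S, f (tailResidues m P) := by
    rw [hSsum, ← hmean, Finset.mul_sum]
    exact Finset.sum_le_sum fun r _ => mul_le_mul_of_nonneg_right (hlow r) (hf r)
  have h1 : ∑ P ∈ S, (complexity P : ℝ) ≤ ∑ P ∈ S, f (tailResidues m P) + S.card * C := by
    rw [← nsmul_eq_mul, ← Finset.sum_const, ← Finset.sum_add_distrib]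
    exact Finset.sum_le_sum fun P hP => by
      simp only [f]
      exact_mod_cast (hC m P hP).1
  have h2 : ∑ P ∈ S, f (tailResidues m P) ≤ ∑ P ∈ S, (complexity P : ℝ) + S.card * C := by
    rw [← nsmul_eq_mul, ← Finset.sum_const, ← Finset.sum_add_distrib]
    exact Finset.sum_le_sum fun P hP => by
      simp only [f]
      exact_mod_cast (hC m P hP).2
  have hSpos : (0 : ℝ) < S.card := (mul_pos hA0 hN).trans_le hle_card
  have hmc := meanCost_nonneg n m
  unfold expectedComplexity
  rw [← hS]
  constructor
  · rw [le_div_iff₀ hSpos, sub_mul]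
    have h3 : A / B * meanCost n m * S.card ≤ A * (N * meanCost n m) := by
      calc A / B * meanCost n m * S.card ≤ A / B * meanCost n m * (B * N) := by gcongr
        _ = A * (N * meanCost n m) := by field_simp
    linarith
  · rw [div_le_iff₀ hSpos, add_mul]
    have h3 : B * (N * meanCost n m) ≤ B / A * meanCost n m * S.card := by
      calc B * (N * meanCost n m) = B / A * meanCost n m * (A * N) := by field_simp
        _ ≤ B / A * meanCost n m * S.card := by gcongr
    linarith

end Fibers

/-! ### The limit -/

theorem tendsto_simplexCard_two_pow_div (n : ℕ) :
    Tendsto (fun j : ℕ => (simplexCard n (2 ^ j - 1) / simplexCard n (2 ^ j - (2 * n + 1)) : ℝ))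
      atTop (𝓝 1) := by
  have hpow : Tendsto (fun j : ℕ => 2 ^ j) atTop atTop :=
    tendsto_pow_atTop_atTop_of_one_lt Nat.one_lt_two
  refine ((tendsto_simplexCard_div n (2 * n)).comp
    ((tendsto_sub_atTop_nat (2 * n + 1)).comp hpow)).congr' ?_
  filter_upwards [hpow.eventually_ge_atTop (2 * n + 1)] with j hj
  simp only [Function.comp_apply]
  rw [show 2 ^ j - (2 * n + 1) + 2 * n = 2 ^ j - 1 by omega]

theorem tendsto_affine_div {f : ℕ → ℝ} {l : ℝ} (hf : Tendsto (fun m : ℕ => f m / m) atTop (𝓝 l))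
    (a C : ℝ) (j : ℕ) :
    Tendsto (fun m : ℕ => (a * f m + C) / ((m + j : ℕ) : ℝ)) atTop (𝓝 (a * l)) := by
  have h1 : Tendsto (fun m : ℕ => (a * (f m / m) + C / m) * ((m : ℝ) / (m + j))) atTop
      (𝓝 ((a * l + 0) * 1)) :=
    ((hf.const_mul a).add (tendsto_const_div_atTop_nhds_zero_nat C)).mul
      (tendsto_natCast_div_add_atTop (j : ℝ))
  rw [add_zero, mul_one] at h1
  refine h1.congr' ?_
  filter_upwards [eventually_gt_atTop 0] with m hm
  have hm' : (m : ℝ) ≠ 0 := Nat.cast_ne_zero.2 hm.ne'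
  push_cast
  field_simp

/-- If `e (m + j)` agrees with `f m` up to a constant and factors that tend to `1` as `j → ∞`,
then `e` inherits the growth rate of `f`. -/
theorem tendsto_div_of_near {e f : ℕ → ℝ} {l : ℝ} {a b : ℕ → ℝ}
    (hf : Tendsto (fun m : ℕ => f m / m) atTop (𝓝 l))
    (ha : Tendsto a atTop (𝓝 1)) (hb : Tendsto b atTop (𝓝 1))
    (h : ∀ᶠ j in atTop, ∃ C : ℝ, ∀ m, a j * f m - C ≤ e (m + j) ∧ e (m + j) ≤ b j * f m + C) :
    Tendsto (fun W : ℕ => e W / W) atTop (𝓝 l) := by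
  have ha' : Tendsto (fun j => a j * l) atTop (𝓝 l) := by simpa using ha.mul_const l
  have hb' : Tendsto (fun j => b j * l) atTop (𝓝 l) := by simpa using hb.mul_const l
  refine tendsto_order.2 ⟨fun y hy => ?_, fun y hy => ?_⟩
  · obtain ⟨j, hj, C, hC⟩ := ((ha'.eventually (lt_mem_nhds hy)).and h).exists
    rw [← map_add_atTop_eq_nat j, eventually_map]
    filter_upwards [(tendsto_affine_div hf (a j) (-C) j).eventually (lt_mem_nhds hj)] with m hm
    refine hm.trans_le ?_
    gcongr
    exact (hC m).1
  · obtain ⟨j, hj, C, hC⟩ := ((hb'.eventually (gt_mem_nhds hy)).and h).exists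
    rw [← map_add_atTop_eq_nat j, eventually_map]
    filter_upwards [(tendsto_affine_div hf (b j) C j).eventually (gt_mem_nhds hj)] with m hm
    refine lt_of_le_of_lt ?_ hm
    gcongr
    exact (hC m).2

theorem tendsto_normalizedExpectedComplexity (n : ℕ) :
    Tendsto (fun W : ℕ => normalizedExpectedComplexity (n + 1) W) atTop
      (𝓝 (meanCostRate n / (n + 1))) := by
  have hb := tendsto_simplexCard_two_pow_div n
  have ha := hb.inv₀ one_ne_zero
  simp only [inv_div, inv_one] at ha
  have h := tendsto_div_of_near (e := expectedComplexity (n + 1)) (tendsto_meanCost_div n) ha hb ?_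
  · refine (h.div_const ((n : ℝ) + 1)).congr fun W => ?_
    rw [normalizedExpectedComplexity, div_div, mul_comm (W : ℝ)]
    push_cast
    rfl
  · have hpow : Tendsto (fun j : ℕ => 2 ^ j) atTop atTop :=
      tendsto_pow_atTop_atTop_of_one_lt Nat.one_lt_two
    filter_upwards [hpow.eventually_ge_atTop (2 * n + 1)] with j hj
    exact exists_expectedComplexity_near n j hj

theorem mainTheorem4 :
    (∀ k : ℕ, 2 ≤ k →
      ∃ L : ℝ, Tendsto (fun W : ℕ => normalizedExpectedComplexity k W) atTop (𝓝 L) ∧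
        L ∈ Set.Icc (1 / 6 : ℝ) (1 / 5)) ∧
    Tendsto (fun W : ℕ => normalizedExpectedComplexity 2 W) atTop (𝓝 (1 / 6 : ℝ)) := by
  constructor
  · intro k hk
    obtain ⟨n, rfl⟩ : ∃ n, k = n + 1 := ⟨k - 1, by omega⟩
    have hn : 1 ≤ n := by omega
    have hpos : (0 : ℝ) < n + 1 := by positivity
    refine ⟨_, tendsto_normalizedExpectedComplexity n, ?_, ?_⟩
    · rw [le_div_iff₀ hpos]
      linarith [meanCostRate_ge hn]
    · rw [div_le_iff₀ hpos]
      linarith [meanCostRate_le hn]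
  · have h1 := meanCostRate_ge le_rfl
    have h2 : meanCostRate 1 = 1 / 3 := by
      refine le_antisymm meanCostRate_one_le ?_
      norm_num at h1 ⊢
      exact h1
    have h := tendsto_normalizedExpectedComplexity 1
    rw [h2] at h
    norm_num at h ⊢
    exact h
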